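/- Let $S^1=\{z\in\mathbb C:|z|=1\}$, let $\sigma_1$ be the normalized uniform (arc length) measure on $S^1$, and for $\lambda>0$ put $$I_\lambda(\sigma_1)=\iint_{S^1\times S^1}|x-y|^\lambda\,d\sigma_1(x)\,d\sigma_1(y),\qquad H_\lambda(y_0,\dots,y_{N-1})=\sum_{0\le i\ne j\le N-1}|y_i-y_j|^\lambda$$ for points $y_0,\dots,y_{N-1}\in S^1$, not necessarily distinct. Let $\mathcal L_\lambda(N)$ denote the $\lambda$-energy $H_\lambda$ of the configuration of the $N$-th roots of unity; thus $\mathcal L_\lambda(N)=N\,2^\lambda\sum_{k=1}^{N-1}\left(\sin\frac{\pi k}{N}\right)^\lambda$ and $\mathcal L_\lambda(1)=0$. A sequence $(a_n)_{n\ge0}\subset S^1$ with $a_0=1$ is called a greedy $\lambda$-energy sequence if $$\sum_{k=0}^{n-1}|a_n-a_k|^\lambda=\max_{x\in S^1}\sum_{k=0}^{n-1}|x-a_k|^\lambda\qquad\text{for all } n\ge1,$$ and we write $\alpha_N=(a_0,\dots,a_{N-1})$. Theorem. Let $1<\lambda<2$, let $(a_n)_{n\ge0}\subset S^1$ be a greedy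 $\lambda$-energy sequence, and put $x_N=H_\lambda(\alpha_N)-N^2I_\lambda(\sigma_1)$ for $N\ge2$. The sequence $(x_N)_{N\ge2}$ is bounded and divergent, and $$\limsup_{N\to\infty}x_N=0 .$$ The series in $$s_\lambda:=\frac13\sum_{k=0}^\infty\left(1+\frac{(-1)^k}{2^{k-1}}\right)\left(\mathcal L_\lambda(2^k)-2^{2k}I_\lambda(\sigma_1)\right)$$ converges, $s_\lambda$ is the limit of $x_N$ along the subsequence $N=(4^p-1)/3$, $p\to\infty$, and $$\liminf_{N\to\infty}x_N\le s_\lambda .$$ Moreover, $$\liminf_{N\to\infty}x_N=\inf_{N\ge2}x_N ,$$ and each term $x_N$, $N\ge2$, is a limit point of the sequence itself, that is, the limit of some subsequence of $(x_N)_{N\ge 2}$. -/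

import Mathlib

open Filter Topology MeasureTheory

noncomputable section

namespace GreedyEnergy

/-- The Borel σ-algebra on the unit circle `S¹ ⊂ ℂ`. -/
instance circleMeasurableSpace : MeasurableSpace Circle := borel Circle

instance circleBorelSpace : BorelSpace Circle := ⟨rfl⟩

/-- The `lam`-energy `∑_{i ≠ j} |y_i - y_j|^lam` of a configuration of `N` points on `S¹`,
not necessarily distinct; the sum is over ordered pairs of distinct indices. -/
def energy (lam : ℝ) {N : ℕ} (y : Fin N → Circle) : ℝ :=
  ∑ p ∈ (Finset.univ : Finset (Fin N)).offDiag, ‖(y p.1 : ℂ) - (y p.2 : ℂ)‖ ^ lam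

/-- The discrete potential `U_n(x) = ∑_{k < n} |x - a_k|^lam`. -/
def discretePotential (lam : ℝ) (a : ℕ → Circle) (n : ℕ) (x : Circle) : ℝ :=
  ∑ k ∈ Finset.range n, ‖(x : ℂ) - (a k : ℂ)‖ ^ lam

/-- `a` is a greedy `lam`-energy sequence on `S¹`: each `a n`, `n ≥ 1`, is a point at which the
potential of the preceding points attains its maximum on `S¹`. -/
def IsGreedy (lam : ℝ) (a : ℕ → Circle) : Prop :=
  ∀ n : ℕ, 1 ≤ n → ∀ x : Circle, discretePotential lam a n x ≤ discretePotential lam a n (a n)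

/-- The `N`-th section `(a_0, …, a_{N-1})` of a sequence. -/
def initialSection (a : ℕ → Circle) (N : ℕ) : Fin N → Circle := fun i => a i

/-- The continuous energy `I_lam(μ) = ∬ |x - y|^lam dμ(x) dμ(y)`. -/
def continuousEnergy (lam : ℝ) (μ : Measure Circle) : ℝ :=
  ∫ x, ∫ y, ‖(x : ℂ) - (y : ℂ)‖ ^ lam ∂μ ∂μ

/-- The normalized uniform (arc length) measure on `S¹`: the image of the probability Haar measure
of `ℝ / ℤ` under `t ↦ exp (2 π i t)`. -/
def uniformCircle : Measure Circle :=
  (AddCircle.haarAddCircle (T := (1 : ℝ))).map AddCircle.toCircle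

/-- The energy of the configuration formed by the `N`-th roots of unity. -/
def rootsEnergy (lam : ℝ) (N : ℕ) : ℝ :=
  energy lam (fun k : Fin N => Circle.exp (2 * Real.pi * (k : ℕ) / N))

/-- The second-order term `H_lam(α_N) - N² I_lam(σ₁)` of the energy of the sections of `a`. -/
def secondOrderEnergy (lam : ℝ) (a : ℕ → Circle) (N : ℕ) : ℝ :=
  energy lam (initialSection a N) - (N : ℝ) ^ 2 * continuousEnergy lam uniformCircle

/-- The `k`-th term `(1 + (-1)^k / 2^(k-1)) (L_lam(2^k) - 2^(2k) I_lam(σ₁))` of the series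
that defines `s_lam`; the exponent `k - 1` is an integer, equal to `-1` for `k = 0`. -/
def sTerm (lam : ℝ) (k : ℕ) : ℝ :=
  (1 + (-1 : ℝ) ^ k / (2 : ℝ) ^ ((k : ℤ) - 1)) *
    (rootsEnergy lam (2 ^ k) - (2 : ℝ) ^ (2 * k) * continuousEnergy lam uniformCircle)

/-- The constant `s_lam`, one third of the sum of the series. -/
def sConst (lam : ℝ) : ℝ := 1 / 3 * ∑' k : ℕ, sTerm lam k

end GreedyEnergy

end

namespace GreedyEnergy

/-! For 0 < p = lam/2 < 1, the power s^p is a positive constant times the integral over t > 0 of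
t^(p-1) (1 - t/(t+s)). The kernel t/(t+s) averages explicitly over 2^n-th roots of unity, because
(t+s)(t+4-s) = (t^2+4t) + s(4-s) and |x^2-1|^2 = s(4-s) when s = |x-1|^2. Hence the potential of
these roots is a strictly increasing function of |x^(2^n) - 1|: it is minimal at the roots and
maximal exactly at their midpoints (`rootPotential_lt`).

So the first 2^n greedy points fill a rotated set of roots, and the points after them lie at
midpoints and are greedy in their own right (`greedyUpTo_tail`). With l_n the second-order energy of
the 2^n-th roots, this gives x(2^n+m) = l_n + x(m) + (m/2^n)(l_(n+1) - 2 l_n) for m ≤ 2^n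
(`secondOrderEnergy_two_pow_add`).

Substituting t^2+4t for t in the integrals shows that l_n is O(2^((1-lam)n)) (`le_rootsRemainder`),
hence summable for lam > 1, and every l_n is negative (`rootsRemainder_neg`). All the assertions
follow from the recursion and these two facts (`IsBinaryRecursive`). -/

/-! ### Averages of the kernel t/(t+s) -/

/-- The average over the `2 ^ n`-th roots of unity `z` of `t / (t + |x - z| ^ 2)`, as a function of
`s = |x ^ (2 ^ n) - 1| ^ 2`. -/
noncomputable def avgKernel : ℕ → ℝ → ℝ → ℝ
  | 0, t, s => t / (t + s)
  | n + 1, t, s => (t + 2) / (t + 4) * avgKernel n (t ^ 2 + 4 * t) s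

/-- The case n = 0 is the factorization of t^2+4t+s(4-s); the recursion then only replaces t by
t^2+4t. It links the recursion in t to squaring the point, which sends s to s(4-s). -/
lemma avgKernel_succ_eq_average (n : ℕ) {t s : ℝ} (ht : 0 < t) (hs₀ : 0 ≤ s) (hs₄ : s ≤ 4) :
    avgKernel (n + 1) t (s * (4 - s)) = (avgKernel n t s + avgKernel n t (4 - s)) / 2 := by
  induction n generalizing t with
  | zero =>
    have h1 : 0 < t + s := by linarith
    have h2 : 0 < t + (4 - s) := by linarith
    have h3 : t ^ 2 + 4 * t + s * (4 - s) = (t + s) * (t + (4 - s)) := by ring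
    simp only [avgKernel]
    rw [h3]
    field_simp
    ring
  | succ n ih =>
    have h := ih (t := t ^ 2 + 4 * t) (by positivity)
    rw [avgKernel, h]
    simp only [avgKernel]
    ring

lemma avgKernel_strictAnti (n : ℕ) {t s s' : ℝ} (ht : 0 < t) (hs : 0 ≤ s) (h : s < s') :
    avgKernel n t s' < avgKernel n t s := by
  induction n generalizing t with
  | zero => simp only [avgKernel]; gcongr
  | succ n ih =>
    have := ih (t := t ^ 2 + 4 * t) (by positivity)
    simp only [avgKernel]
    gcongr

lemma avgKernel_succ_zero_lt (n : ℕ) {t : ℝ} (ht : 0 < t) :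
    avgKernel (n + 1) t 0 < avgKernel n t 0 := by
  induction n generalizing t with
  | zero =>
    simp only [avgKernel, add_zero]
    rw [div_self ht.ne', div_self (by positivity), mul_one, div_lt_one (by positivity)]
    linarith
  | succ n ih =>
    have := ih (t := t ^ 2 + 4 * t) (by positivity)
    change (t + 2) / (t + 4) * avgKernel (n + 1) (t ^ 2 + 4 * t) 0 <
      (t + 2) / (t + 4) * avgKernel n (t ^ 2 + 4 * t) 0
    gcongr

/-! ### Integrals over the half-line and the substitution t^2+4t -/

lemma setIntegral_Ioi_lt {f g : ℝ → ℝ} (hf : IntegrableOn f (Set.Ioi 0))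
    (hg : IntegrableOn g (Set.Ioi 0)) (h : ∀ t, 0 < t → f t < g t) :
    ∫ t in Set.Ioi 0, f t < ∫ t in Set.Ioi 0, g t := by
  rw [← sub_pos, ← integral_sub hg hf]
  refine (setIntegral_pos_iff_support_of_nonneg_ae ?_ (hg.sub hf)).2 ?_
  · filter_upwards [ae_restrict_mem measurableSet_Ioi] with t ht
    simpa using (h t ht).le
  · have : Function.support (g - f) ∩ Set.Ioi 0 = Set.Ioi 0 := by
      refine Set.inter_eq_right.2 fun t ht => ?_
      simpa using (sub_pos.2 (h t ht)).ne'
    rw [this]; simp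

lemma image_sq_add_four_mul_Ioi : (fun t : ℝ => t ^ 2 + 4 * t) '' Set.Ioi 0 = Set.Ioi 0 := by
  ext y
  constructor
  · rintro ⟨t, ht, rfl⟩
    have : (0 : ℝ) < t := ht
    exact Set.mem_Ioi.2 (by positivity)
  · intro hy
    have hy : (0 : ℝ) < y := hy
    refine ⟨√(y + 4) - 2, ?_, ?_⟩
    · rw [Set.mem_Ioi, sub_pos, Real.lt_sqrt (by norm_num)]
      linarith
    · have := Real.sq_sqrt (show 0 ≤ y + 4 by linarith)
      simp only
      nlinarith

lemma hasDerivWithinAt_sq_add_four_mul (t : ℝ) (_ : t ∈ Set.Ioi (0 : ℝ)) :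
    HasDerivWithinAt (fun t : ℝ => t ^ 2 + 4 * t) (2 * t + 4) (Set.Ioi 0) t := by
  have h := ((hasDerivAt_id' t).fun_pow 2).fun_add ((hasDerivAt_id' t).const_mul 4)
  simpa using h.hasDerivWithinAt

lemma monotoneOn_sq_add_four_mul : MonotoneOn (fun t : ℝ => t ^ 2 + 4 * t) (Set.Ioi 0) := by
  intro x hx y hy h
  have : (0 : ℝ) < x := hx
  simp only
  gcongr

/-- The change of variables `t ↦ t ^ 2 + 4 t` of the half-line. -/
lemma integral_comp_sq_add_four_mul (F : ℝ → ℝ) :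
    ∫ t in Set.Ioi 0, F t = ∫ t in Set.Ioi 0, (2 * t + 4) * F (t ^ 2 + 4 * t) := by
  have := integral_image_eq_integral_deriv_smul_of_monotoneOn measurableSet_Ioi
    hasDerivWithinAt_sq_add_four_mul monotoneOn_sq_add_four_mul F
  rw [image_sq_add_four_mul_Ioi] at this
  simpa using this

lemma integrableOn_comp_sq_add_four_mul {F : ℝ → ℝ} (hF : IntegrableOn F (Set.Ioi 0)) :
    IntegrableOn (fun t => (2 * t + 4) * F (t ^ 2 + 4 * t)) (Set.Ioi 0) := by
  have := integrableOn_image_iff_integrableOn_deriv_smul_of_monotoneOn measurableSet_Ioi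
    hasDerivWithinAt_sq_add_four_mul monotoneOn_sq_add_four_mul F
  rw [image_sq_add_four_mul_Ioi] at this
  simpa using this.1 hF

/-- The comparison of the increments of the averages at the root `1` for consecutive `n`. -/
lemma integral_avgKernel_sub_succ_le {p : ℝ} (hp₀ : 0 < p) (n : ℕ)
    (hi : ∀ m, IntegrableOn (fun t => t ^ (p - 1) * (avgKernel m t 0 - avgKernel (m + 1) t 0))
      (Set.Ioi 0)) :
    ∫ t in Set.Ioi 0, t ^ (p - 1) * (avgKernel (n + 1) t 0 - avgKernel (n + 2) t 0) ≤
      1 / 2 * 4 ^ (-p) *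
        ∫ t in Set.Ioi 0, t ^ (p - 1) * (avgKernel n t 0 - avgKernel (n + 1) t 0) := by
  -- After the substitution both integrands contain the same kernel difference at t^2+4t, and the
  -- quotient of their weights is 4^(-p) (t+4)^p ≥ 1.
  rw [integral_comp_sq_add_four_mul
    (fun t => t ^ (p - 1) * (avgKernel n t 0 - avgKernel (n + 1) t 0)), ← integral_const_mul]
  refine setIntegral_mono_on (hi (n + 1))
    ((integrableOn_comp_sq_add_four_mul (hi n)).const_mul _) measurableSet_Ioi fun t ht => ?_
  have ht : (0 : ℝ) < t := ht
  have hγ := avgKernel_succ_zero_lt n (t := t ^ 2 + 4 * t) (by positivity)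
  change t ^ (p - 1) * ((t + 2) / (t + 4) * avgKernel n (t ^ 2 + 4 * t) 0 -
      (t + 2) / (t + 4) * avgKernel (n + 1) (t ^ 2 + 4 * t) 0) ≤ 1 / 2 * 4 ^ (-p) *
    ((2 * t + 4) * ((t ^ 2 + 4 * t) ^ (p - 1) *
      (avgKernel n (t ^ 2 + 4 * t) 0 - avgKernel (n + 1) (t ^ 2 + 4 * t) 0)))
  set γ := avgKernel n (t ^ 2 + 4 * t) 0 - avgKernel (n + 1) (t ^ 2 + 4 * t) 0 with hγ'
  have hγ0 : 0 ≤ γ := by linarith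
  have e1 : (t ^ 2 + 4 * t) ^ (p - 1) = t ^ (p - 1) * ((t + 4) ^ p / (t + 4)) := by
    rw [show t ^ 2 + 4 * t = t * (t + 4) by ring, Real.mul_rpow ht.le (by positivity),
      Real.rpow_sub_one (x := t + 4) (by positivity)]
  have e2 : (1 : ℝ) ≤ 4 ^ (-p) * (t + 4) ^ p := by
    rw [Real.rpow_neg (by norm_num), inv_mul_eq_div, one_le_div (by positivity)]
    exact Real.rpow_le_rpow (by norm_num) (by linarith) hp₀.le
  have : 0 ≤ t ^ (p - 1) * ((t + 2) / (t + 4)) * γ := by positivity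
  calc t ^ (p - 1) * ((t + 2) / (t + 4) * avgKernel n (t ^ 2 + 4 * t) 0 -
          (t + 2) / (t + 4) * avgKernel (n + 1) (t ^ 2 + 4 * t) 0)
      = t ^ (p - 1) * ((t + 2) / (t + 4)) * γ * 1 := by rw [hγ']; ring
    _ ≤ t ^ (p - 1) * ((t + 2) / (t + 4)) * γ * (4 ^ (-p) * (t + 4) ^ p) := by gcongr
    _ = _ := by rw [e1]; ring

/-! ### Roots of unity of order 2^n and chord lengths -/

open scoped Classical in
/-- The `2 ^ n`-th roots of unity, built by adjoining half-step rotations. -/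
noncomputable def dyadicRoots : ℕ → Finset Circle
  | 0 => {1}
  | n + 1 => dyadicRoots n ∪ (dyadicRoots n).image (Circle.exp (Real.pi / 2 ^ n) * ·)

lemma circle_exp_pi : Circle.exp Real.pi = -1 := by
  ext; simp

lemma circle_exp_pi_div_pow (n : ℕ) : Circle.exp (Real.pi / 2 ^ n) ^ 2 ^ n = -1 := by
  rw [← Circle.exp_nsmul, nsmul_eq_mul, ← circle_exp_pi]
  congr 1
  push_cast
  field_simp

lemma circle_sq_eq_one_iff (x : Circle) : x ^ 2 = 1 ↔ x = 1 ∨ x = -1 := by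
  constructor
  · intro h
    have : (x : ℂ) ^ 2 = 1 := by exact_mod_cast congrArg (fun y : Circle => (y : ℂ)) h
    rcases eq_or_eq_neg_of_sq_eq_sq _ 1 (this.trans (one_pow 2).symm) with h | h
    · left; ext; simpa using h
    · right; ext; simpa using h
  · rintro (rfl | rfl) <;> simp

lemma mem_dyadicRoots {n : ℕ} {z : Circle} : z ∈ dyadicRoots n ↔ z ^ 2 ^ n = 1 := by
  induction n generalizing z with
  | zero => simp [dyadicRoots]
  | succ n ih =>
    have hw := circle_exp_pi_div_pow n
    rw [pow_succ, pow_mul, circle_sq_eq_one_iff]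
    simp only [dyadicRoots, Finset.mem_union, Finset.mem_image, ih]
    refine or_congr Iff.rfl ⟨?_, fun h => ⟨(Circle.exp (Real.pi / 2 ^ n))⁻¹ * z, ?_, by simp⟩⟩
    · rintro ⟨y, hy, rfl⟩
      rw [mul_pow, hw, hy, mul_one]
    · rw [mul_pow, inv_pow, hw, h]; simp

lemma circle_one_ne_neg_one : (1 : Circle) ≠ -1 := by
  intro h
  have : (1 : ℂ) = -1 := by simpa using congrArg (fun y : Circle => (y : ℂ)) h
  norm_num at this

/-- The `2 ^ (n + 1)`-th roots of unity are the `2 ^ n`-th ones and a half-step rotation of them. -/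
lemma sum_dyadicRoots_succ {n : ℕ} {w : Circle} (hw : w ^ 2 ^ n = -1) (g : Circle → ℝ) :
    ∑ z ∈ dyadicRoots (n + 1), g z =
      ∑ z ∈ dyadicRoots n, g z + ∑ z ∈ dyadicRoots n, g (w * z) := by
  classical
  have h : dyadicRoots (n + 1) = dyadicRoots n ∪ (dyadicRoots n).image (w * ·) := by
    ext z
    simp only [Finset.mem_union, Finset.mem_image, mem_dyadicRoots]
    rw [pow_succ, pow_mul, circle_sq_eq_one_iff]
    refine or_congr Iff.rfl ⟨fun h => ⟨w⁻¹ * z, ?_, by simp⟩, ?_⟩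
    · rw [mul_pow, inv_pow, hw, h]; simp
    · rintro ⟨y, hy, rfl⟩
      rw [mul_pow, hw, hy, mul_one]
  rw [h, Finset.sum_union, Finset.sum_image fun _ _ _ _ h => mul_left_cancel h]
  rw [Finset.disjoint_left]
  intro z hz hz'
  obtain ⟨y, hy, rfl⟩ := Finset.mem_image.1 hz'
  rw [mem_dyadicRoots] at hz hy
  rw [mul_pow, hw, hy, mul_one] at hz
  exact circle_one_ne_neg_one hz.symm

lemma sum_dyadicRoots_mul {n : ℕ} {c : Circle} (hc : c ^ 2 ^ n = 1) (g : Circle → ℝ) :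
    ∑ z ∈ dyadicRoots n, g (c * z) = ∑ z ∈ dyadicRoots n, g z := by
  refine Finset.sum_bij' (fun z _ => c * z) (fun z _ => c⁻¹ * z) ?_ ?_ ?_ ?_ ?_ <;>
    simp +contextual [mem_dyadicRoots, mul_pow, hc]

lemma card_dyadicRoots (n : ℕ) : (dyadicRoots n).card = 2 ^ n := by
  have : ∑ z ∈ dyadicRoots n, (1 : ℝ) = 2 ^ n := by
    induction n with
    | zero => simp [dyadicRoots]
    | succ n ih =>
      rw [sum_dyadicRoots_succ (circle_exp_pi_div_pow n) (fun _ => 1), ih]; ring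
  rw [Finset.sum_const, nsmul_eq_mul, mul_one] at this
  exact_mod_cast this

/-- The squared distance to `1`. -/
noncomputable def chordSq (x : Circle) : ℝ := ‖(x : ℂ) - 1‖ ^ 2

lemma chordSq_eq (x : Circle) : chordSq x = 2 - 2 * (x : ℂ).re := by
  have h : (x : ℂ).re ^ 2 + (x : ℂ).im ^ 2 = 1 := by
    have := Circle.normSq_coe x
    rw [Complex.normSq_apply] at this
    linarith
  rw [chordSq, ← Complex.normSq_eq_norm_sq, Complex.normSq_apply]
  simp only [Complex.sub_re, Complex.sub_im, Complex.one_re, Complex.one_im]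
  linarith

lemma chordSq_nonneg (x : Circle) : 0 ≤ chordSq x := by unfold chordSq; positivity

@[simp] lemma chordSq_one : chordSq 1 = 0 := by simp [chordSq]

lemma chordSq_neg (x : Circle) : chordSq (-x) = 4 - chordSq x := by
  simp only [chordSq_eq, Circle.coe_neg, Complex.neg_re]; ring

lemma chordSq_le_four (x : Circle) : chordSq x ≤ 4 := by
  have := chordSq_nonneg (-x)
  rw [chordSq_neg] at this
  linarith

lemma chordSq_sq (x : Circle) : chordSq (x ^ 2) = chordSq x * (4 - chordSq x) := by
  rw [← chordSq_neg]
  simp only [chordSq]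
  rw [← mul_pow, ← norm_mul, ← norm_neg]
  congr 2
  push_cast
  ring

lemma chordSq_neg_one : chordSq (-1) = 4 := by rw [chordSq_neg]; simp

lemma chordSq_lt_four {x : Circle} (hx : x ≠ -1) : chordSq x < 4 := by
  refine lt_of_le_of_ne (chordSq_le_four x) fun h => hx ?_
  have h' : chordSq (-x) = 0 := by rw [chordSq_neg, h]; ring
  have : ((-x : Circle) : ℂ) - 1 = 0 := by simpa [chordSq] using h'
  have : -x = 1 := by ext; simpa [sub_eq_zero] using this
  rw [← this, neg_neg]

lemma norm_sub_eq_norm_div_sub_one (x z : Circle) : ‖(x : ℂ) - z‖ = ‖((x / z : Circle) : ℂ) - 1‖ := by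
  have : (x : ℂ) - z = (((x / z : Circle) : ℂ) - 1) * z := by
    rw [Circle.coe_div]; field_simp [Circle.coe_ne_zero]
  rw [this, norm_mul, Circle.norm_coe, mul_one]

lemma norm_sub_rpow (lam : ℝ) (x z : Circle) :
    ‖(x : ℂ) - z‖ ^ lam = chordSq (x / z) ^ (lam / 2) := by
  rw [norm_sub_eq_norm_div_sub_one, chordSq, ← Real.rpow_natCast, ← Real.rpow_mul (norm_nonneg _)]
  congr 1
  push_cast
  ring

/-! ### The potential of the roots of unity -/

/-- The potential of the `2 ^ n`-th roots of unity. -/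
noncomputable def rootPotential (lam : ℝ) (n : ℕ) (x : Circle) : ℝ :=
  ∑ z ∈ dyadicRoots n, ‖(x : ℂ) - z‖ ^ lam

/-- Splitting the roots into two cosets gives the values at x^(2^n) and at its negative, whose
squared chords are s and 4-s; their average is one step of the kernel recursion. -/
lemma sum_avgKernel_zero (n : ℕ) {t : ℝ} (ht : 0 < t) (x : Circle) :
    ∑ z ∈ dyadicRoots n, avgKernel 0 t (chordSq (x / z)) =
      2 ^ n * avgKernel n t (chordSq (x ^ 2 ^ n)) := by
  induction n generalizing x with
  | zero => simp [dyadicRoots]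
  | succ n ih =>
    have hw := circle_exp_pi_div_pow n
    rw [sum_dyadicRoots_succ hw fun z => avgKernel 0 t (chordSq (x / z))]
    simp only [div_mul_eq_div_div]
    have h : (x / Circle.exp (Real.pi / 2 ^ n)) ^ 2 ^ n = -x ^ 2 ^ n := by
      rw [div_pow, hw, div_eq_mul_inv, inv_neg, inv_one, mul_neg, mul_one]
    rw [ih, ih, h, chordSq_neg, pow_succ (2 : ℕ) n, pow_mul x, chordSq_sq,
      avgKernel_succ_eq_average n ht (chordSq_nonneg _) (chordSq_le_four _)]
    ring

/-- The normalizing constant of the integral representation of `s ^ p`. -/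
noncomputable def rpowConst (p : ℝ) : ℝ := (∫ t in Set.Ioi 0, Real.rpowIntegrand₀₁ p t 1)⁻¹

lemma rpowConst_pos {p : ℝ} (hp : p ∈ Set.Ioo 0 1) : 0 < rpowConst p :=
  inv_pos.2 (Real.integral_rpowIntegrand₀₁_one_pos hp)

lemma rpowIntegrand₀₁_eq_avgKernel {p t s : ℝ} (hp : p ∈ Set.Ioo 0 1) (ht : 0 < t) (hs : 0 ≤ s) :
    Real.rpowIntegrand₀₁ p t s = t ^ (p - 1) * (1 - avgKernel 0 t s) := by
  rw [Real.rpowIntegrand₀₁_eq_pow_div hp ht.le hs, avgKernel]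
  have : 0 < t + s := by positivity
  field_simp
  ring

lemma sum_rpowIntegrand₀₁ {p t : ℝ} (hp : p ∈ Set.Ioo 0 1) (ht : 0 < t) (n : ℕ) (x : Circle) :
    ∑ z ∈ dyadicRoots n, Real.rpowIntegrand₀₁ p t (chordSq (x / z)) =
      2 ^ n * (t ^ (p - 1) * (1 - avgKernel n t (chordSq (x ^ 2 ^ n)))) := by
  rw [Finset.sum_congr rfl fun z _ => rpowIntegrand₀₁_eq_avgKernel hp ht (chordSq_nonneg (x / z)),
    ← Finset.mul_sum, Finset.sum_sub_distrib, sum_avgKernel_zero n ht, Finset.sum_const,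
    card_dyadicRoots, nsmul_eq_mul]
  push_cast
  ring

lemma integrableOn_avgKernel {p : ℝ} (hp : p ∈ Set.Ioo 0 1) (n : ℕ) (x : Circle) :
    IntegrableOn (fun t => t ^ (p - 1) * (1 - avgKernel n t (chordSq (x ^ 2 ^ n)))) (Set.Ioi 0) := by
  have h : IntegrableOn (fun t => ((2 : ℝ) ^ n)⁻¹ *
      ∑ z ∈ dyadicRoots n, Real.rpowIntegrand₀₁ p t (chordSq (x / z))) (Set.Ioi 0) :=
    (integrable_finsetSum _ fun z _ =>
      Real.integrableOn_rpowIntegrand₀₁_Ioi hp (chordSq_nonneg (x / z))).const_mul _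
  refine h.congr_fun (fun t ht => ?_) measurableSet_Ioi
  simp only
  rw [sum_rpowIntegrand₀₁ hp ht, inv_mul_cancel_left₀ (by positivity)]

lemma rootPotential_eq_integral {lam : ℝ} (hp : lam / 2 ∈ Set.Ioo (0 : ℝ) 1) (n : ℕ) (x : Circle) :
    rootPotential lam n x = rpowConst (lam / 2) * (2 ^ n *
      ∫ t in Set.Ioi 0, t ^ (lam / 2 - 1) * (1 - avgKernel n t (chordSq (x ^ 2 ^ n)))) := by
  rw [rootPotential, Finset.sum_congr rfl fun z _ => (norm_sub_rpow lam x z).trans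
    (Real.rpow_eq_const_mul_integral hp (chordSq_nonneg (x / z))), ← Finset.mul_sum,
    ← integral_finsetSum _ fun z _ =>
      Real.integrableOn_rpowIntegrand₀₁_Ioi hp (chordSq_nonneg (x / z))]
  have e : Set.EqOn
      (fun t => ∑ z ∈ dyadicRoots n, Real.rpowIntegrand₀₁ (lam / 2) t (chordSq (x / z)))
      (fun t => 2 ^ n * (t ^ (lam / 2 - 1) * (1 - avgKernel n t (chordSq (x ^ 2 ^ n)))))
      (Set.Ioi 0) := fun t ht => sum_rpowIntegrand₀₁ hp ht n x
  rw [rpowConst, setIntegral_congr_fun measurableSet_Ioi e, integral_const_mul]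

/-- The averaged kernel strictly decreases in the squared chord for each t > 0, so the integrand of
the potential strictly increases. -/
lemma rootPotential_lt {lam : ℝ} (hp : lam / 2 ∈ Set.Ioo (0 : ℝ) 1) (n : ℕ) {x y : Circle}
    (h : chordSq (x ^ 2 ^ n) < chordSq (y ^ 2 ^ n)) :
    rootPotential lam n x < rootPotential lam n y := by
  rw [rootPotential_eq_integral hp, rootPotential_eq_integral hp]
  have := rpowConst_pos hp
  gcongr
  refine setIntegral_Ioi_lt (integrableOn_avgKernel hp n x) (integrableOn_avgKernel hp n y)
    fun t ht => ?_
  have := avgKernel_strictAnti n ht (chordSq_nonneg _) h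
  gcongr

lemma rootPotential_le {lam : ℝ} (hp : lam / 2 ∈ Set.Ioo (0 : ℝ) 1) (n : ℕ) {x y : Circle}
    (h : chordSq (x ^ 2 ^ n) ≤ chordSq (y ^ 2 ^ n)) :
    rootPotential lam n x ≤ rootPotential lam n y := by
  rcases h.lt_or_eq with h | h
  · exact (rootPotential_lt hp n h).le
  · rw [rootPotential_eq_integral hp, rootPotential_eq_integral hp, h]

/-- The normalized increment of the potential at the root `1`. -/
noncomputable def rootIncrement (lam : ℝ) (n : ℕ) : ℝ :=
  rootPotential lam (n + 1) 1 / 2 ^ (n + 1) - rootPotential lam n 1 / 2 ^ n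

lemma integrableOn_avgKernel_sub {p : ℝ} (hp : p ∈ Set.Ioo 0 1) (n : ℕ) :
    IntegrableOn (fun t => t ^ (p - 1) * (avgKernel n t 0 - avgKernel (n + 1) t 0))
      (Set.Ioi 0) := by
  have h0 := integrableOn_avgKernel hp n 1
  have h1 := integrableOn_avgKernel hp (n + 1) 1
  simp only [one_pow, chordSq_one] at h0 h1
  refine (h1.sub h0).congr_fun (fun t _ => ?_) measurableSet_Ioi
  simp only [Pi.sub_apply]
  ring

lemma rootIncrement_eq_integral {lam : ℝ} (hp : lam / 2 ∈ Set.Ioo (0 : ℝ) 1) (n : ℕ) :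
    rootIncrement lam n = rpowConst (lam / 2) * ∫ t in Set.Ioi 0,
      t ^ (lam / 2 - 1) * (avgKernel n t 0 - avgKernel (n + 1) t 0) := by
  have h0 := integrableOn_avgKernel hp n 1
  have h1 := integrableOn_avgKernel hp (n + 1) 1
  simp only [one_pow, chordSq_one] at h0 h1
  have e : ∀ t : ℝ, t ^ (lam / 2 - 1) * (avgKernel n t 0 - avgKernel (n + 1) t 0) =
      t ^ (lam / 2 - 1) * (1 - avgKernel (n + 1) t 0) -
        t ^ (lam / 2 - 1) * (1 - avgKernel n t 0) := fun t => by ring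
  rw [rootIncrement, rootPotential_eq_integral hp, rootPotential_eq_integral hp]
  simp only [e, one_pow, chordSq_one]
  rw [integral_sub h1 h0]
  field_simp

lemma rootIncrement_pos {lam : ℝ} (hp : lam / 2 ∈ Set.Ioo (0 : ℝ) 1) (n : ℕ) :
    0 < rootIncrement lam n := by
  rw [rootIncrement_eq_integral hp]
  refine mul_pos (rpowConst_pos hp) ?_
  have := setIntegral_Ioi_lt (f := fun _ => 0) integrableOn_zero
    (integrableOn_avgKernel_sub hp n) fun t ht =>
      mul_pos (Real.rpow_pos_of_pos ht _) (sub_pos.2 (avgKernel_succ_zero_lt n ht))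
  simpa using this

lemma rootIncrement_succ_le {lam : ℝ} (hp : lam / 2 ∈ Set.Ioo (0 : ℝ) 1) (n : ℕ) :
    rootIncrement lam (n + 1) ≤ 1 / 2 * 4 ^ (-(lam / 2)) * rootIncrement lam n := by
  rw [rootIncrement_eq_integral hp, rootIncrement_eq_integral hp, mul_left_comm]
  exact mul_le_mul_of_nonneg_left
    (integral_avgKernel_sub_succ_le hp.1 n (integrableOn_avgKernel_sub hp)) (rpowConst_pos hp).le

/-- The increments decay by a factor 4^(-lam/2)/2 per level; the weight 4^n, the square of the
number of points, turns this ratio into 2 * 4^(-lam/2) = 2^(1-lam). -/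
lemma rootIncrement_le {lam : ℝ} (hp : lam / 2 ∈ Set.Ioo (0 : ℝ) 1) (n : ℕ) :
    4 ^ n * rootIncrement lam n ≤ (2 * 4 ^ (-(lam / 2))) ^ n * rootIncrement lam 0 := by
  induction n with
  | zero => simp
  | succ n ih =>
    calc 4 ^ (n + 1) * rootIncrement lam (n + 1)
        ≤ 4 ^ (n + 1) * (1 / 2 * 4 ^ (-(lam / 2)) * rootIncrement lam n) := by
          gcongr; exact rootIncrement_succ_le hp n
      _ = (2 * 4 ^ (-(lam / 2))) * (4 ^ n * rootIncrement lam n) := by ring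
      _ ≤ (2 * 4 ^ (-(lam / 2))) * ((2 * 4 ^ (-(lam / 2))) ^ n * rootIncrement lam 0) := by gcongr
      _ = _ := by ring

lemma rootPotential_mul {lam : ℝ} {n : ℕ} {c : Circle} (hc : c ^ 2 ^ n = 1) (x : Circle) :
    rootPotential lam n (c * x) = rootPotential lam n x := by
  simp only [rootPotential, norm_sub_rpow]
  rw [← sum_dyadicRoots_mul hc]
  simp only [mul_div_mul_left_eq_div]

/-- The potential at the midpoints of the `2 ^ n`-th roots of unity. -/
lemma rootPotential_midpoint {lam : ℝ} {n : ℕ} {w : Circle} (hw : w ^ 2 ^ n = -1) :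
    rootPotential lam n w = rootPotential lam (n + 1) 1 - rootPotential lam n 1 := by
  have hw' : w⁻¹ ^ 2 ^ n = -1 := by rw [inv_pow, hw]; simp
  simp only [rootPotential, norm_sub_rpow]
  rw [sum_dyadicRoots_succ hw' fun z => chordSq (1 / z) ^ (lam / 2)]
  simp only [div_mul_eq_div_div, one_div, inv_inv]
  ring

/-! ### Uniform measure, mean potential and energy of the roots -/

instance isProbabilityMeasure_uniformCircle : IsProbabilityMeasure uniformCircle :=
  Measure.isProbabilityMeasure_map AddCircle.continuous_toCircle.measurable.aemeasurable

lemma surjective_toCircle : Function.Surjective (AddCircle.toCircle (T := (1 : ℝ))) := by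
  intro x
  refine ⟨((Complex.arg x / (2 * Real.pi) : ℝ) : AddCircle (1 : ℝ)), ?_⟩
  rw [AddCircle.toCircle_apply_mk, div_one, mul_div_cancel₀ _ (by positivity), Circle.exp_arg]

lemma integral_uniformCircle_mul {g : Circle → ℝ} (hg : Continuous g) (x : Circle) :
    ∫ y, g (x * y) ∂uniformCircle = ∫ y, g y ∂uniformCircle := by
  obtain ⟨s, rfl⟩ := surjective_toCircle x
  have hm : AEMeasurable (AddCircle.toCircle (T := (1 : ℝ))) AddCircle.haarAddCircle :=
    AddCircle.continuous_toCircle.measurable.aemeasurable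
  have hc : Continuous fun y => g (AddCircle.toCircle s * y) := by fun_prop
  rw [uniformCircle, integral_map hm hc.aestronglyMeasurable,
    integral_map hm hg.aestronglyMeasurable]
  simp only [← AddCircle.toCircle_add]
  exact integral_add_left_eq_self (μ := AddCircle.haarAddCircle)
    (fun t => g (AddCircle.toCircle t)) s

lemma continuous_norm_sub_rpow {lam : ℝ} (hlam : 0 ≤ lam) (z : Circle) :
    Continuous fun x : Circle => ‖(x : ℂ) - z‖ ^ lam := by
  refine Continuous.rpow_const (by fun_prop) fun _ => Or.inr hlam

lemma integral_norm_sub_rpow {lam : ℝ} (hlam : 0 ≤ lam) (z : Circle) :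
    ∫ x, ‖(x : ℂ) - z‖ ^ lam ∂uniformCircle = ∫ x, ‖(x : ℂ) - (1 : Circle)‖ ^ lam ∂uniformCircle := by
  rw [← integral_uniformCircle_mul (continuous_norm_sub_rpow hlam 1) z⁻¹]
  congr with x
  rw [norm_sub_rpow, norm_sub_rpow, div_one, inv_mul_eq_div]

lemma continuousEnergy_uniformCircle {lam : ℝ} (hlam : 0 ≤ lam) :
    continuousEnergy lam uniformCircle =
      ∫ x, ‖(x : ℂ) - (1 : Circle)‖ ^ lam ∂uniformCircle := by
  have h : (fun x : Circle => ∫ y : Circle, ‖(x : ℂ) - y‖ ^ lam ∂uniformCircle) =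
      fun _ => ∫ x, ‖(x : ℂ) - (1 : Circle)‖ ^ lam ∂uniformCircle := by
    funext x
    rw [← integral_norm_sub_rpow hlam x]
    congr with y
    rw [norm_sub_rev]
  refine (congrArg (fun f => ∫ x, f x ∂uniformCircle) h).trans ?_
  simp

lemma integrable_uniformCircle {g : Circle → ℝ} (hg : Continuous g) :
    Integrable g uniformCircle :=
  hg.integrable_of_hasCompactSupport (HasCompactSupport.of_compactSpace g)

lemma continuous_rootPotential {lam : ℝ} (hlam : 0 ≤ lam) (n : ℕ) :
    Continuous (rootPotential lam n) :=
  continuous_finsetSum _ fun z _ => continuous_norm_sub_rpow hlam z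

/-- The mean of the potential of the `2 ^ n`-th roots of unity. -/
lemma integral_rootPotential {lam : ℝ} (hlam : 0 ≤ lam) (n : ℕ) :
    ∫ x, rootPotential lam n x ∂uniformCircle =
      2 ^ n * continuousEnergy lam uniformCircle := by
  simp only [rootPotential]
  rw [integral_finsetSum _ fun z _ => integrable_uniformCircle (continuous_norm_sub_rpow hlam z)]
  simp only [integral_norm_sub_rpow hlam]
  rw [Finset.sum_const, card_dyadicRoots, continuousEnergy_uniformCircle hlam]
  simp

/-- The potential is minimal at a root, so its value there is at most its mean. -/
lemma rootPotential_one_le {lam : ℝ} (hp : lam / 2 ∈ Set.Ioo (0 : ℝ) 1) (n : ℕ) :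
    rootPotential lam n 1 ≤ 2 ^ n * continuousEnergy lam uniformCircle := by
  have hlam : 0 ≤ lam := by linarith [hp.1]
  rw [← integral_rootPotential hlam]
  have := integral_mono (μ := uniformCircle) (integrable_const (rootPotential lam n 1))
    (integrable_uniformCircle (continuous_rootPotential hlam n))
    fun x => rootPotential_le hp n (by rw [one_pow, chordSq_one]; exact chordSq_nonneg _)
  simpa using this

lemma le_rootPotential_midpoint {lam : ℝ} (hp : lam / 2 ∈ Set.Ioo (0 : ℝ) 1) {n : ℕ} {w : Circle}
    (hw : w ^ 2 ^ n = -1) :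
    2 ^ n * continuousEnergy lam uniformCircle ≤ rootPotential lam n w := by
  have hlam : 0 ≤ lam := by linarith [hp.1]
  rw [← integral_rootPotential hlam]
  have := integral_mono (μ := uniformCircle)
    (integrable_uniformCircle (continuous_rootPotential hlam n))
    (integrable_const (rootPotential lam n w))
    fun x => rootPotential_le hp n (by rw [hw, chordSq_neg_one]; exact chordSq_le_four _)
  simpa using this

/-- The energy as a double sum. -/
lemma energy_eq_sum_sum {lam : ℝ} (hlam : lam ≠ 0) {N : ℕ} (y : Fin N → Circle) :
    energy lam y = ∑ i, ∑ j, ‖(y i : ℂ) - y j‖ ^ lam := by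
  rw [energy, ← Fintype.sum_prod_type' fun i j => ‖(y i : ℂ) - y j‖ ^ lam]
  refine Finset.sum_subset (Finset.subset_univ _) fun p _ hp => ?_
  have : p.1 = p.2 := by simpa using hp
  rw [this]
  simp [Real.zero_rpow hlam]

lemma sum_range_two_mul (f : ℕ → ℝ) (m : ℕ) :
    ∑ k ∈ Finset.range (2 * m), f k =
      ∑ k ∈ Finset.range m, f (2 * k) + ∑ k ∈ Finset.range m, f (2 * k + 1) := by
  induction m with
  | zero => simp
  | succ m ih =>
    rw [show 2 * (m + 1) = 2 * m + 1 + 1 by ring, Finset.sum_range_succ, Finset.sum_range_succ, ih,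
      Finset.sum_range_succ, Finset.sum_range_succ]
    ring

lemma sum_range_exp (n : ℕ) (g : Circle → ℝ) :
    ∑ k ∈ Finset.range (2 ^ n), g (Circle.exp (2 * Real.pi * k / (2 ^ n : ℕ))) =
      ∑ z ∈ dyadicRoots n, g z := by
  induction n generalizing g with
  | zero => simp [dyadicRoots]
  | succ n ih =>
    rw [sum_dyadicRoots_succ (circle_exp_pi_div_pow n), pow_succ', sum_range_two_mul, ← ih, ← ih]
    congr 1 <;> refine Finset.sum_congr rfl fun k _ => ?_
    · congr 2
      push_cast
      field_simp
    · rw [← Circle.exp_add]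
      congr 2
      push_cast
      field_simp
      ring

lemma rootsEnergy_two_pow {lam : ℝ} (hlam : lam ≠ 0) (n : ℕ) :
    rootsEnergy lam (2 ^ n) = 2 ^ n * rootPotential lam n 1 := by
  rw [rootsEnergy, energy_eq_sum_sum hlam]
  have h : ∀ x : Circle, ∑ j : Fin (2 ^ n),
      ‖(x : ℂ) - Circle.exp (2 * Real.pi * (j : ℕ) / (2 ^ n : ℕ))‖ ^ lam = rootPotential lam n x := by
    intro x
    rw [rootPotential, ← sum_range_exp, ← Fin.sum_univ_eq_sum_range
      fun k : ℕ => ‖(x : ℂ) - Circle.exp (2 * Real.pi * k / (2 ^ n : ℕ))‖ ^ lam]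
  simp only [h]
  rw [Fin.sum_univ_eq_sum_range
      fun k : ℕ => rootPotential lam n (Circle.exp (2 * Real.pi * k / (2 ^ n : ℕ))),
    sum_range_exp n (rootPotential lam n)]
  have : ∀ z ∈ dyadicRoots n, rootPotential lam n z = rootPotential lam n 1 := fun z hz => by
    simpa using rootPotential_mul (lam := lam) (mem_dyadicRoots.1 hz) 1
  rw [Finset.sum_congr rfl this, Finset.sum_const, card_dyadicRoots]
  simp

/-! ### Sign and decay of the second-order term of the roots -/

/-- The second-order term of the energy of the `2 ^ n`-th roots of unity. -/
noncomputable def rootsRemainder (lam : ℝ) (n : ℕ) : ℝ :=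
  rootsEnergy lam (2 ^ n) - 4 ^ n * continuousEnergy lam uniformCircle

lemma rootsRemainder_eq {lam : ℝ} (hlam : lam ≠ 0) (n : ℕ) :
    rootsRemainder lam n =
      -(2 ^ n * (2 ^ n * continuousEnergy lam uniformCircle - rootPotential lam n 1)) := by
  rw [rootsRemainder, rootsEnergy_two_pow hlam, show (4 : ℝ) = 2 ^ 2 by norm_num, ← pow_mul,
    mul_comm 2 n, pow_mul]
  ring

lemma rootsRemainder_nonpos {lam : ℝ} (hp : lam / 2 ∈ Set.Ioo (0 : ℝ) 1) (n : ℕ) :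
    rootsRemainder lam n ≤ 0 := by
  rw [rootsRemainder_eq (by linarith [hp.1] : 0 < lam).ne']
  have := sub_nonneg.2 (rootPotential_one_le hp n)
  simp only [Left.neg_nonpos_iff]
  positivity

/-- The normalized values at the root 1 strictly increase with n and are all bounded by the
continuous energy, so none of them attains it. -/
lemma rootsRemainder_neg {lam : ℝ} (hp : lam / 2 ∈ Set.Ioo (0 : ℝ) 1) (n : ℕ) :
    rootsRemainder lam n < 0 := by
  rw [rootsRemainder_eq (by linarith [hp.1] : 0 < lam).ne']
  have h1 := rootPotential_one_le hp (n + 1)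
  have h2 := rootIncrement_pos hp n
  have h3 : rootPotential lam (n + 1) 1 / 2 ^ (n + 1) ≤ continuousEnergy lam uniformCircle := by
    rw [div_le_iff₀' (by positivity)]; exact h1
  have h4 : rootPotential lam n 1 / 2 ^ n < continuousEnergy lam uniformCircle := by
    rw [rootIncrement] at h2; linarith
  rw [div_lt_iff₀' (by positivity)] at h4
  have := sub_pos.2 h4
  simp only [Left.neg_neg_iff]
  positivity

/-- The mean is at most the midpoint value U_(n+1)(1) - U_n(1), where U_n is the potential of the
2^n-th roots. The gap between the mean and U_n(1) is thus at most U_(n+1)(1) - 2 U_n(1), which is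
2^(n+1) times the increment. -/
lemma le_rootsRemainder {lam : ℝ} (hp : lam / 2 ∈ Set.Ioo (0 : ℝ) 1) (n : ℕ) :
    -(2 * rootIncrement lam 0 * (2 * 4 ^ (-(lam / 2))) ^ n) ≤ rootsRemainder lam n := by
  rw [rootsRemainder_eq (by linarith [hp.1] : 0 < lam).ne', neg_le_neg_iff]
  have h1 := le_rootPotential_midpoint hp (circle_exp_pi_div_pow n)
  rw [rootPotential_midpoint (circle_exp_pi_div_pow n)] at h1
  have h2 := rootIncrement_le hp n
  have h4 : (4 : ℝ) ^ n = 2 ^ n * 2 ^ n := by rw [← mul_pow]; norm_num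
  have h3 : 4 ^ n * (2 * rootIncrement lam n) =
      2 ^ n * (rootPotential lam (n + 1) 1 - 2 * rootPotential lam n 1) := by
    rw [rootIncrement, h4]
    field_simp
    ring
  have h5 : (2 : ℝ) ^ n * (2 ^ n * continuousEnergy lam uniformCircle - rootPotential lam n 1) ≤
      2 ^ n * (rootPotential lam (n + 1) 1 - 2 * rootPotential lam n 1) := by
    exact mul_le_mul_of_nonneg_left (by linarith) (by positivity)
  linarith

/-! ### Structure of greedy sequences -/

/-- The first `M` points of `a` are chosen greedily. -/
def GreedyUpTo (lam : ℝ) (a : ℕ → Circle) (M : ℕ) : Prop :=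
  ∀ k : ℕ, 1 ≤ k → k < M → ∀ x : Circle,
    discretePotential lam a k x ≤ discretePotential lam a k (a k)

lemma IsGreedy.greedyUpTo {lam : ℝ} {a : ℕ → Circle} (h : IsGreedy lam a) (M : ℕ) :
    GreedyUpTo lam a M :=
  fun k hk _ => h k hk

lemma GreedyUpTo.mono {lam : ℝ} {a : ℕ → Circle} {M M' : ℕ} (h : GreedyUpTo lam a M)
    (hM : M' ≤ M) : GreedyUpTo lam a M' :=
  fun k hk hk' => h k hk (hk'.trans_le hM)

lemma discretePotential_congr {lam : ℝ} {a b : ℕ → Circle} {n : ℕ} (h : ∀ k < n, a k = b k)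
    (x : Circle) : discretePotential lam a n x = discretePotential lam b n x :=
  Finset.sum_congr rfl fun k hk => by rw [h k (Finset.mem_range.1 hk)]

lemma discretePotential_add (lam : ℝ) (a : ℕ → Circle) (n m : ℕ) (x : Circle) :
    discretePotential lam a (n + m) x =
      discretePotential lam a n x + discretePotential lam (fun j => a (n + j)) m x :=
  Finset.sum_range_add _ _ _

lemma exists_discretePotential_max {lam : ℝ} (hlam : 0 ≤ lam) (a : ℕ → Circle) (n : ℕ) :
    ∃ x, ∀ y, discretePotential lam a n y ≤ discretePotential lam a n x := by
  have hc : Continuous (discretePotential lam a n) :=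
    continuous_finsetSum _ fun k _ => continuous_norm_sub_rpow hlam (a k)
  obtain ⟨x, -, hx⟩ := isCompact_univ.exists_isMaxOn Set.univ_nonempty hc.continuousOn
  exact ⟨x, fun y => hx (Set.mem_univ y)⟩

/-- Greedy configurations of at most `2 ^ n` points consist of rotated `2 ^ n`-th roots of unity. -/
def GreedyInRoots (lam : ℝ) (n : ℕ) : Prop :=
  ∀ (a : ℕ → Circle) (M : ℕ), M ≤ 2 ^ n → GreedyUpTo lam a M → ∀ k < M, (a k / a 0) ^ 2 ^ n = 1

/-- Greedy configurations of `2 ^ n` points are rotations of the `2 ^ n`-th roots of unity. -/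
def GreedyFillsRoots (lam : ℝ) (n : ℕ) : Prop :=
  ∀ a : ℕ → Circle, GreedyUpTo lam a (2 ^ n) → ∀ g : Circle → ℝ,
    ∑ k ∈ Finset.range (2 ^ n), g (a k) = ∑ z ∈ dyadicRoots n, g (a 0 * z)

lemma GreedyFillsRoots.discretePotential_eq {lam : ℝ} {n : ℕ} (h : GreedyFillsRoots lam n)
    {a : ℕ → Circle} (ha : GreedyUpTo lam a (2 ^ n)) (x : Circle) :
    discretePotential lam a (2 ^ n) x = rootPotential lam n (x / a 0) := by
  rw [discretePotential, h a ha fun y => ‖(x : ℂ) - y‖ ^ lam, rootPotential]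
  simp only [norm_sub_rpow, div_mul_eq_div_div]

lemma rootPotential_le_midpoint {lam : ℝ} (hp : lam / 2 ∈ Set.Ioo (0 : ℝ) 1) {n : ℕ} {w : Circle}
    (hw : w ^ 2 ^ n = -1) (x : Circle) : rootPotential lam n x ≤ rootPotential lam n w :=
  rootPotential_le hp n (by rw [hw, chordSq_neg_one]; exact chordSq_le_four _)

lemma pow_eq_neg_one_of_rootPotential_max {lam : ℝ} (hp : lam / 2 ∈ Set.Ioo (0 : ℝ) 1) {n : ℕ}
    {w : Circle} (h : ∀ x, rootPotential lam n x ≤ rootPotential lam n w) : w ^ 2 ^ n = -1 := by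
  by_contra hw
  refine (h (Circle.exp (Real.pi / 2 ^ n))).not_gt (rootPotential_lt hp n ?_)
  rw [circle_exp_pi_div_pow, chordSq_neg_one]
  exact chordSq_lt_four hw

/-- The points of a greedy sequence that follow the first `2 ^ n` ones are greedy themselves and
are midpoints of the first ones. -/
lemma greedyUpTo_tail {lam : ℝ} (hp : lam / 2 ∈ Set.Ioo (0 : ℝ) 1) {n : ℕ}
    (hR : GreedyInRoots lam n) (hS : GreedyFillsRoots lam n) {a : ℕ → Circle} {m : ℕ}
    (hm : m ≤ 2 ^ n) (ha : GreedyUpTo lam a (2 ^ n + m)) :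
    GreedyUpTo lam (fun j => a (2 ^ n + j)) m ∧ ∀ j < m, (a (2 ^ n + j) / a 0) ^ 2 ^ n = -1 := by
  induction m with
  | zero => exact ⟨fun k _ hk => absurd hk (by simp), fun j hj => absurd hj (by simp)⟩
  | succ m ih =>
    obtain ⟨hb, hmid⟩ := ih (by omega) (ha.mono (by omega))
    set b : ℕ → Circle := fun j => a (2 ^ n + j) with hbdef
    have hpos : 0 < 2 ^ n := by positivity
    have hmax : ∀ x, rootPotential lam n (x / a 0) + discretePotential lam b m x ≤
        rootPotential lam n (b m / a 0) + discretePotential lam b m (b m) := by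
      intro x
      have := ha (2 ^ n + m) (by omega) (by omega) x
      rwa [discretePotential_add, discretePotential_add,
        hS.discretePotential_eq (ha.mono (by omega)),
        hS.discretePotential_eq (ha.mono (by omega))] at this
    -- A maximizer of the tail potential that is also a midpoint. For m = 0 that potential vanishes
    -- and any midpoint serves; otherwise appending a maximizer to the tail keeps it greedy with at
    -- most 2^n points, so the maximizer differs from the midpoint `b 0` by a 2^n-th root of unity.
    obtain ⟨x, hx, hxmid⟩ : ∃ x, (∀ y, discretePotential lam b m y ≤ discretePotential lam b m x) ∧
        (x / a 0) ^ 2 ^ n = -1 := by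
      rcases Nat.eq_zero_or_pos m with rfl | hm0
      · refine ⟨Circle.exp (Real.pi / 2 ^ n) * a 0, by simp [discretePotential], ?_⟩
        rw [mul_div_cancel_right, circle_exp_pi_div_pow]
      · obtain ⟨x, hx⟩ := exists_discretePotential_max (by linarith [hp.1] : 0 ≤ lam) b m
        refine ⟨x, hx, ?_⟩
        have hc : GreedyUpTo lam (Function.update b m x) (m + 1) := by
          intro k hk hk' y
          have hlt : ∀ j < k, Function.update b m x j = b j := fun j hj =>
            Function.update_of_ne (by omega) _ _
          rw [discretePotential_congr hlt, discretePotential_congr hlt]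
          rcases Nat.lt_succ_iff_lt_or_eq.1 hk' with h | rfl
          · rw [Function.update_of_ne h.ne]; exact hb k hk h y
          · rw [Function.update_self]; exact hx y
        have h1 := hR _ _ hm hc m (by omega)
        rw [Function.update_self, Function.update_of_ne hm0.ne] at h1
        have h2 := hmid 0 hm0
        rw [show x / a 0 = x / b 0 * (b 0 / a 0) by simp, mul_pow, h1, one_mul]
        exact h2
    -- Since `x` maximizes both summands at once, any maximizer of the sum, in particular `b m`,
    -- maximizes each of them.
    have h1 := hmax x
    have h2 := hx (b m)
    have h3 := rootPotential_le_midpoint hp hxmid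
    have hbmax : ∀ y, discretePotential lam b m y ≤ discretePotential lam b m (b m) := fun y => by
      linarith [hx y, h3 (b m / a 0)]
    have hbmid : (b m / a 0) ^ 2 ^ n = -1 :=
      pow_eq_neg_one_of_rootPotential_max hp fun y => by linarith [h3 y]
    constructor
    · intro k hk hk'
      rcases Nat.lt_succ_iff_lt_or_eq.1 hk' with h | rfl
      · exact hb k hk h
      · exact hbmax
    · intro j hj
      rcases Nat.lt_succ_iff_lt_or_eq.1 hj with h | rfl
      · exact hmid j h
      · exact hbmid

/-- The two properties support each other: both at level n yield the midpoint structure of the next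
block, whose coset completes the roots of level n+1. -/
lemma greedyInRoots_and_fillsRoots {lam : ℝ} (hp : lam / 2 ∈ Set.Ioo (0 : ℝ) 1) (n : ℕ) :
    GreedyInRoots lam n ∧ GreedyFillsRoots lam n := by
  induction n with
  | zero =>
    refine ⟨fun a M hM ha k hk => ?_, fun a ha g => by simp [dyadicRoots]⟩
    rw [pow_zero] at hM
    obtain rfl : k = 0 := by omega
    simp
  | succ n ih =>
    obtain ⟨hR, hS⟩ := ih
    have hpos : 0 < 2 ^ n := by positivity
    constructor
    · intro a M hM ha k hk
      rw [pow_succ, pow_mul]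
      rw [pow_succ] at hM
      rcases lt_or_ge k (2 ^ n) with h | h
      · rw [hR a (min M (2 ^ n)) (min_le_right _ _) (ha.mono (min_le_left _ _)) k
          (lt_min hk h), one_pow]
      · obtain ⟨m, rfl⟩ : ∃ m, M = 2 ^ n + m := ⟨M - 2 ^ n, by omega⟩
        obtain ⟨j, rfl⟩ : ∃ j, k = 2 ^ n + j := ⟨k - 2 ^ n, by omega⟩
        rw [(greedyUpTo_tail hp hR hS (by omega) ha).2 j (by omega)]
        simp
    · intro a ha g
      have h2 : 2 ^ (n + 1) = 2 ^ n + 2 ^ n := by ring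
      rw [h2] at ha ⊢
      obtain ⟨hb, hmid⟩ := greedyUpTo_tail hp hR hS le_rfl ha
      rw [Finset.sum_range_add, hS a (ha.mono (by omega)) g, hS _ hb g,
        sum_dyadicRoots_succ (hmid 0 hpos) fun z => g (a 0 * z)]
      simp [← mul_assoc]

/-! ### Energy of greedy sections -/

/-- The double sum of the energy of the first `N` points. -/
noncomputable def sectionEnergy (lam : ℝ) (a : ℕ → Circle) (N : ℕ) : ℝ :=
  ∑ i ∈ Finset.range N, discretePotential lam a N (a i)

lemma energy_initialSection {lam : ℝ} (hlam : lam ≠ 0) (a : ℕ → Circle) (N : ℕ) :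
    energy lam (initialSection a N) = sectionEnergy lam a N := by
  rw [energy_eq_sum_sum hlam, sectionEnergy, ← Fin.sum_univ_eq_sum_range
    fun i => discretePotential lam a N (a i)]
  refine Finset.sum_congr rfl fun i _ => ?_
  rw [discretePotential, ← Fin.sum_univ_eq_sum_range fun k => ‖(a i : ℂ) - a k‖ ^ lam]
  rfl

lemma sum_discretePotential_comm (lam : ℝ) (a b : ℕ → Circle) (n m : ℕ) :
    ∑ i ∈ Finset.range n, discretePotential lam b m (a i) =
      ∑ j ∈ Finset.range m, discretePotential lam a n (b j) := by
  simp only [discretePotential]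
  rw [Finset.sum_comm]
  simp only [norm_sub_rev]

lemma sectionEnergy_add (lam : ℝ) (a : ℕ → Circle) (n m : ℕ) :
    sectionEnergy lam a (n + m) = sectionEnergy lam a n +
      sectionEnergy lam (fun j => a (n + j)) m +
        2 * ∑ j ∈ Finset.range m, discretePotential lam a n (a (n + j)) := by
  simp only [sectionEnergy, Finset.sum_range_add, discretePotential_add, Finset.sum_add_distrib]
  rw [sum_discretePotential_comm lam a (fun j => a (n + j)) n m]
  ring

/-- The first block has constant potential on its own points and, because the tail consists of
midpoints, constant potential on the tail; the cross term is therefore explicit. -/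
lemma sectionEnergy_two_pow_add {lam : ℝ} (hp : lam / 2 ∈ Set.Ioo (0 : ℝ) 1) {n m : ℕ}
    {a : ℕ → Circle} (hm : m ≤ 2 ^ n) (ha : GreedyUpTo lam a (2 ^ n + m)) :
    sectionEnergy lam a (2 ^ n + m) = 2 ^ n * rootPotential lam n 1 +
      sectionEnergy lam (fun j => a (2 ^ n + j)) m +
        2 * (m * (rootPotential lam (n + 1) 1 - rootPotential lam n 1)) := by
  obtain ⟨hR, hS⟩ := greedyInRoots_and_fillsRoots hp n
  have ha' : GreedyUpTo lam a (2 ^ n) := ha.mono (by omega)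
  have hmid := (greedyUpTo_tail hp hR hS hm ha).2
  rw [sectionEnergy_add]
  congr 2
  · rw [sectionEnergy, Finset.sum_congr rfl (g := fun _ => rootPotential lam n 1)]
    · simp
    · intro i hi
      rw [hS.discretePotential_eq ha',
        ← rootPotential_mul (hR a _ le_rfl ha' i (Finset.mem_range.1 hi)) 1, mul_one]
  · rw [Finset.sum_congr rfl
      (g := fun _ => rootPotential lam (n + 1) 1 - rootPotential lam n 1)]
    · rw [Finset.sum_const, Finset.card_range, nsmul_eq_mul]
    · intro j hj
      rw [hS.discretePotential_eq ha', rootPotential_midpoint (hmid j (Finset.mem_range.1 hj))]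

/-- The energy of a greedy configuration depends only on the number of points. -/
lemma sectionEnergy_eq_of_greedyUpTo {lam : ℝ} (hp : lam / 2 ∈ Set.Ioo (0 : ℝ) 1) (N : ℕ)
    {a b : ℕ → Circle} (ha : GreedyUpTo lam a N) (hb : GreedyUpTo lam b N) :
    sectionEnergy lam a N = sectionEnergy lam b N := by
  induction N using Nat.strong_induction_on generalizing a b with
  | _ N ih =>
    rcases Nat.eq_zero_or_pos N with rfl | hN
    · simp [sectionEnergy]
    · obtain ⟨n, h1, h2⟩ : ∃ n, 2 ^ n ≤ N ∧ N < 2 ^ n * 2 :=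
        ⟨Nat.log 2 N, Nat.pow_log_le_self 2 hN.ne', Nat.lt_pow_succ_log_self one_lt_two N⟩
      have hpos : 0 < 2 ^ n := by positivity
      obtain ⟨m, rfl⟩ : ∃ m, N = 2 ^ n + m := ⟨N - 2 ^ n, by omega⟩
      obtain ⟨hR, hS⟩ := greedyInRoots_and_fillsRoots hp n
      have hm : m ≤ 2 ^ n := by omega
      rw [sectionEnergy_two_pow_add hp hm ha, sectionEnergy_two_pow_add hp hm hb,
        ih m (by omega) (greedyUpTo_tail hp hR hS hm ha).1 (greedyUpTo_tail hp hR hS hm hb).1]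

/-- The recursion of the second-order energy along the binary expansion. -/
lemma secondOrderEnergy_two_pow_add {lam : ℝ} (hp : lam / 2 ∈ Set.Ioo (0 : ℝ) 1) {a : ℕ → Circle}
    (ha : IsGreedy lam a) {n m : ℕ} (hm : m ≤ 2 ^ n) :
    secondOrderEnergy lam a (2 ^ n + m) = rootsRemainder lam n + secondOrderEnergy lam a m +
      m / 2 ^ n * (rootsRemainder lam (n + 1) - 2 * rootsRemainder lam n) := by
  have hlam : lam ≠ 0 := (by linarith [hp.1] : 0 < lam).ne'
  obtain ⟨hR, hS⟩ := greedyInRoots_and_fillsRoots hp n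
  have ha' := ha.greedyUpTo (2 ^ n + m)
  have h := sectionEnergy_eq_of_greedyUpTo hp m (greedyUpTo_tail hp hR hS hm ha').1
    (ha.greedyUpTo m)
  simp only [secondOrderEnergy, energy_initialSection hlam, rootsRemainder_eq hlam]
  rw [sectionEnergy_two_pow_add hp hm ha', h]
  push_cast
  field_simp
  ring

/-! ### Sequences with a binary recursion -/

/-- Sequences built along binary expansions from the values `l n` at the powers of two. -/
structure IsBinaryRecursive (l x : ℕ → ℝ) : Prop where
  zero : x 0 = 0
  two_pow_add : ∀ n m : ℕ, m < 2 ^ n →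
    x (2 ^ n + m) = l n + x m + m / 2 ^ n * (l (n + 1) - 2 * l n)
  neg : ∀ n, l n < 0
  summable : Summable l

namespace IsBinaryRecursive

variable {l x : ℕ → ℝ}

lemma map_two_pow (h : IsBinaryRecursive l x) (n : ℕ) : x (2 ^ n) = l n := by
  simpa [h.zero] using h.two_pow_add n 0 (by positivity)

lemma exists_eq_two_pow_add {n M : ℕ} (hM : M < 2 ^ (n + 1)) (hn : 2 ^ n ≤ M) :
    ∃ m < 2 ^ n, M = 2 ^ n + m :=
  ⟨M - 2 ^ n, by rw [pow_succ] at hM; omega, by omega⟩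

/-- Nonpositivity alone does not pass through the induction, since -2 l_n is positive. With θ =
k/2^n, the bound x(k) ≤ (2θ-1) l_n cancels every l_n term in x(2^n+k) and leaves θ l_(n+1), which is
exactly the second bound one level up. -/
lemma nonpos_and_le (h : IsBinaryRecursive l x) (n : ℕ) {m : ℕ} (hm : m < 2 ^ n) :
    x m ≤ 0 ∧ x m ≤ (2 * m / 2 ^ n - 1) * l n := by
  induction n generalizing m with
  | zero =>
    obtain rfl : m = 0 := by simpa using hm
    simp [h.zero, (h.neg 0).le]
  | succ n ih =>
    rcases lt_or_ge m (2 ^ n) with hlt | hge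
    · refine ⟨(ih hlt).1, (ih hlt).1.trans (mul_nonneg_of_nonpos_of_nonpos ?_ (h.neg _).le)⟩
      have : (m : ℝ) < 2 ^ n := by exact_mod_cast hlt
      rw [sub_nonpos, div_le_one (by positivity), pow_succ]
      linarith
    · obtain ⟨k, hk, rfl⟩ := exists_eq_two_pow_add hm hge
      obtain ⟨h1, h2⟩ := ih hk
      have hθ : (0 : ℝ) ≤ k / 2 ^ n := by positivity
      have h3 := mul_nonpos_of_nonneg_of_nonpos hθ (h.neg (n + 1)).le
      have e1 : (2 * k / 2 ^ n - 1) * l n = 2 * (k / 2 ^ n * l n) - l n := by ring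
      have e2 : (2 * ((2 ^ n + k : ℕ) : ℝ) / 2 ^ (n + 1) - 1) * l (n + 1) =
          k / 2 ^ n * l (n + 1) := by
        push_cast; rw [pow_succ]; field_simp; ring
      rw [e1] at h2
      rw [e2, h.two_pow_add n k hk]
      constructor <;> linarith

lemma nonpos (h : IsBinaryRecursive l x) (N : ℕ) : x N ≤ 0 :=
  (h.nonpos_and_le N (Nat.lt_two_pow_self)).1

/-- As m/2^n < 1, each binary digit contributes at most 3|l_k| + |l_(k+1)|, which is summable. -/
lemma exists_abs_le (h : IsBinaryRecursive l x) : ∃ C, ∀ N, |x N| ≤ C := by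
  have hs : Summable fun k => 3 * |l k| + |l (k + 1)| :=
    (h.summable.abs.mul_left 3).add ((summable_nat_add_iff 1).2 h.summable.abs)
  have hb : ∀ n m, m < 2 ^ n → |x m| ≤ ∑ k ∈ Finset.range n, (3 * |l k| + |l (k + 1)|) := by
    intro n
    induction n with
    | zero =>
      intro m hm
      obtain rfl : m = 0 := by simpa using hm
      simp [h.zero]
    | succ n ih =>
      intro m hm
      rw [Finset.sum_range_succ]
      rcases lt_or_ge m (2 ^ n) with hlt | hge
      · have := ih m hlt
        have : 0 ≤ 3 * |l n| + |l (n + 1)| := by positivity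
        linarith
      · obtain ⟨k, hk, rfl⟩ := exists_eq_two_pow_add hm hge
        have h1 := ih k hk
        have hθ : |(k : ℝ) / 2 ^ n| ≤ 1 := by
          rw [abs_of_nonneg (by positivity), div_le_one (by positivity)]
          exact_mod_cast hk.le
        have h2 : |(k : ℝ) / 2 ^ n * (l (n + 1) - 2 * l n)| ≤ |l (n + 1)| + 2 * |l n| := by
          rw [abs_mul]
          calc _ ≤ 1 * |l (n + 1) - 2 * l n| := by gcongr
            _ ≤ |l (n + 1)| + |2 * l n| := by rw [one_mul]; exact abs_sub _ _
            _ = _ := by rw [abs_mul]; norm_num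
        rw [h.two_pow_add n k hk]
        have h3 := abs_add_three (l n) (x k) (k / 2 ^ n * (l (n + 1) - 2 * l n))
        linarith
  exact ⟨_, fun N => (hb N N Nat.lt_two_pow_self).trans
    (hs.sum_le_tsum _ fun k _ => by positivity)⟩

lemma exists_tendsto_subseq (h : IsBinaryRecursive l x) (N : ℕ) :
    ∃ φ : ℕ → ℕ, StrictMono φ ∧ Tendsto (fun k => x (φ k)) atTop (𝓝 (x N)) := by
  -- Adding a distant leading digit to `N` changes the value by a quantity tending to 0; the shift
  -- of the exponent by `N` ensures that `N < 2 ^ (k + N)`.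
  refine ⟨fun k => 2 ^ (k + N) + N, fun i j hij => ?_, ?_⟩
  · have : 2 ^ (i + N) < 2 ^ (j + N) := Nat.pow_lt_pow_right (by norm_num) (by omega)
    simp only
    omega
  · have e : ∀ k, x (2 ^ (k + N) + N) = l (k + N) + x N +
        N / 2 ^ (k + N) * (l (k + N + 1) - 2 * l (k + N)) := fun k =>
      h.two_pow_add _ _ (Nat.lt_two_pow_self.trans_le
        (Nat.pow_le_pow_right (by norm_num) (by omega)))
    simp only [e]
    have h0 := h.summable.tendsto_atTop_zero
    have h1 : Tendsto (fun k => l (k + N)) atTop (𝓝 0) := (tendsto_add_atTop_iff_nat N).2 h0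
    have h2 : Tendsto (fun k => l (k + N + 1)) atTop (𝓝 0) :=
      (tendsto_add_atTop_iff_nat (f := fun k => l (k + 1)) N).2 ((tendsto_add_atTop_iff_nat 1).2 h0)
    have h3 : Tendsto (fun k : ℕ => (N : ℝ) / 2 ^ (k + N)) atTop (𝓝 0) :=
      tendsto_const_nhds.div_atTop ((tendsto_add_atTop_iff_nat (f := fun k => (2 : ℝ) ^ k) N).2
        (tendsto_pow_atTop_atTop_of_one_lt (by norm_num)))
    have := (h1.add_const (x N)).add (h3.mul (h2.sub (h1.const_mul 2)))
    simpa using this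

lemma tendsto_two_pow (h : IsBinaryRecursive l x) :
    Tendsto (fun n => x (2 ^ n)) atTop (𝓝 0) := by
  simpa only [h.map_two_pow] using h.summable.tendsto_atTop_zero

/-- Two limit points differ: 0 along the powers of two, and x(2) = l_1 < 0. -/
lemma not_tendsto (h : IsBinaryRecursive l x) : ¬ ∃ c, Tendsto x atTop (𝓝 c) := by
  rintro ⟨c, hc⟩
  obtain ⟨φ, hφ, hφ'⟩ := h.exists_tendsto_subseq (2 ^ 1)
  have h1 := tendsto_nhds_unique (hc.comp hφ.tendsto_atTop) hφ'
  have h2 := tendsto_nhds_unique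
    (hc.comp (tendsto_pow_atTop_atTop_of_one_lt (one_lt_two : 1 < 2))) h.tendsto_two_pow
  have := h.neg 1
  rw [h.map_two_pow] at h1
  linarith

lemma isBoundedUnder_le (h : IsBinaryRecursive l x) : IsBoundedUnder (· ≤ ·) atTop x :=
  isBoundedUnder_of ⟨0, h.nonpos⟩

lemma isBoundedUnder_ge (h : IsBinaryRecursive l x) : IsBoundedUnder (· ≥ ·) atTop x := by
  obtain ⟨C, hC⟩ := h.exists_abs_le
  exact isBoundedUnder_of ⟨-C, fun N => (abs_le.1 (hC N)).1⟩

lemma liminf_le (h : IsBinaryRecursive l x) {φ : ℕ → ℕ} (hφ : Tendsto φ atTop atTop) {c : ℝ}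
    (hc : Tendsto (fun k => x (φ k)) atTop (𝓝 c)) : liminf x atTop ≤ c := by
  refine le_of_forall_gt_imp_ge_of_dense fun b hb => ?_
  exact liminf_le_of_frequently_le
    (hφ.frequently ((hc.eventually_lt_const hb).mono fun _ hk => hk.le).frequently)
    h.isBoundedUnder_ge

lemma limsup_eq_zero (h : IsBinaryRecursive l x) : limsup x atTop = 0 := by
  apply le_antisymm
  · exact limsup_le_of_le h.isBoundedUnder_ge.isCoboundedUnder_le
      (Eventually.of_forall h.nonpos)
  · refine le_of_forall_lt_imp_le_of_dense fun b hb => ?_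
    exact le_limsup_of_frequently_le
      ((tendsto_pow_atTop_atTop_of_one_lt (one_lt_two : 1 < 2)).frequently
        ((h.tendsto_two_pow.eventually_const_lt hb).mono fun _ hk => hk.le).frequently)
      h.isBoundedUnder_le

/-- Every term is a limit point, hence at least the liminf; conversely, a lower bound of the terms
with N ≥ 2 bounds the sequence eventually. -/
lemma isGLB_liminf (h : IsBinaryRecursive l x) :
    IsGLB (x '' {N | 2 ≤ N}) (liminf x atTop) := by
  constructor
  · rintro _ ⟨N, -, rfl⟩
    obtain ⟨φ, hφ, hφ'⟩ := h.exists_tendsto_subseq N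
    exact h.liminf_le hφ.tendsto_atTop hφ'
  · intro b hb
    refine le_liminf_of_le h.isBoundedUnder_le.isCoboundedUnder_ge ?_
    filter_upwards [eventually_ge_atTop 2] with N hN
    exact hb ⟨N, hN, rfl⟩

/-- These indices have alternating binary digits: each is 4^p plus its predecessor m = (4^p-1)/3.
With θ = m/4^p = (1-4^(-p))/3, the new coefficients are 1-2θ for l_(2p) and θ for l_(2p+1), one
third of those in `s`. -/
lemma map_four_pow_sub_one_div_three (h : IsBinaryRecursive l x) {s : ℕ → ℝ}
    (hs₀ : ∀ k, s (2 * k) = (1 + 2 / 4 ^ k) * l (2 * k))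
    (hs₁ : ∀ k, s (2 * k + 1) = (1 - 1 / 4 ^ k) * l (2 * k + 1)) (p : ℕ) :
    x ((4 ^ p - 1) / 3) = 1 / 3 * ∑ k ∈ Finset.range (2 * p), s k := by
  induction p with
  | zero => simp [h.zero]
  | succ p ih =>
    obtain ⟨m, hm⟩ : ∃ m, 4 ^ p = 3 * m + 1 := by
      have : 4 ^ p % 3 = 1 := by simp [Nat.pow_mod]
      exact ⟨4 ^ p / 3, by omega⟩
    have h4 : 2 ^ (2 * p) = 4 ^ p := by rw [pow_mul]; norm_num
    have h4' : (2 : ℝ) ^ (2 * p) = 4 ^ p := by rw [pow_mul]; norm_num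
    have e1 : (4 ^ p - 1) / 3 = m := by omega
    have e2 : (4 ^ (p + 1) - 1) / 3 = 2 ^ (2 * p) + m := by rw [h4, pow_succ]; omega
    rw [e1] at ih
    rw [e2, h.two_pow_add (2 * p) m (by omega), ih, show 2 * (p + 1) = 2 * p + 1 + 1 by ring,
      Finset.sum_range_succ, Finset.sum_range_succ, hs₀, hs₁, h4']
    have hm' : (m : ℝ) = (4 ^ p - 1) / 3 := by
      have : (4 : ℝ) ^ p = 3 * m + 1 := by exact_mod_cast hm
      linarith
    rw [hm']
    field_simp
    ring

end IsBinaryRecursive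

/-! ### Application to the greedy energy -/

lemma summable_rootsRemainder {lam : ℝ} (hlam₁ : 1 < lam) (hlam₂ : lam < 2) :
    Summable (rootsRemainder lam) := by
  have hp : lam / 2 ∈ Set.Ioo (0 : ℝ) 1 := ⟨by linarith, by linarith⟩
  -- The ratio is 2^(1-lam), less than 1 precisely because lam > 1.
  have hq : 2 * (4 : ℝ) ^ (-(lam / 2)) < 1 := by
    have h : (4 : ℝ) ^ (-(lam / 2)) < 4 ^ (-(1 / 2) : ℝ) :=
      Real.rpow_lt_rpow_of_exponent_lt (by norm_num) (by linarith)
    have h2 : (4 : ℝ) ^ (-(1 / 2) : ℝ) = 1 / 2 := by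
      rw [Real.rpow_neg (by norm_num), ← Real.sqrt_eq_rpow, show (4 : ℝ) = 2 ^ 2 by norm_num,
        Real.sqrt_sq (by norm_num)]
      norm_num
    linarith
  refine Summable.of_norm_bounded (g := fun n => 2 * rootIncrement lam 0 *
    (2 * 4 ^ (-(lam / 2))) ^ n) ((summable_geometric_of_lt_one (by positivity) hq).mul_left _)
    fun n => ?_
  rw [Real.norm_eq_abs, abs_of_nonpos (rootsRemainder_nonpos hp n)]
  linarith [le_rootsRemainder hp n]

lemma isBinaryRecursive_secondOrderEnergy {lam : ℝ} (hlam₁ : 1 < lam) (hlam₂ : lam < 2)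
    {a : ℕ → Circle} (ha : IsGreedy lam a) :
    IsBinaryRecursive (rootsRemainder lam) (secondOrderEnergy lam a) := by
  have hp : lam / 2 ∈ Set.Ioo (0 : ℝ) 1 := ⟨by linarith, by linarith⟩
  exact ⟨by simp [secondOrderEnergy, energy],
    fun n m hm => secondOrderEnergy_two_pow_add hp ha hm.le,
    rootsRemainder_neg hp, summable_rootsRemainder hlam₁ hlam₂⟩

lemma sTerm_eq (lam : ℝ) (k : ℕ) :
    sTerm lam k = (1 + 2 * (-1) ^ k / 2 ^ k) * rootsRemainder lam k := by
  rw [sTerm, rootsRemainder, pow_mul, show (2 : ℝ) ^ 2 = 4 by norm_num,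
    zpow_sub₀ (by norm_num), zpow_natCast, zpow_one]
  field_simp

lemma summable_sTerm {lam : ℝ} (hlam₁ : 1 < lam) (hlam₂ : lam < 2) : Summable (sTerm lam) := by
  refine Summable.of_norm_bounded ((summable_rootsRemainder hlam₁ hlam₂).norm.mul_left 3)
    fun k => ?_
  rw [sTerm_eq, norm_mul]
  gcongr
  have h1 : (1 : ℝ) ≤ 2 ^ k := one_le_pow₀ (by norm_num)
  calc ‖(1 : ℝ) + 2 * (-1) ^ k / 2 ^ k‖ ≤ ‖(1 : ℝ)‖ + ‖2 * (-1 : ℝ) ^ k / 2 ^ k‖ := norm_add_le _ _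
    _ = 1 + 2 / 2 ^ k := by simp
    _ ≤ 1 + 2 / 1 := by gcongr
    _ = 3 := by norm_num

lemma tendsto_secondOrderEnergy_sConst {lam : ℝ} (hlam₁ : 1 < lam) (hlam₂ : lam < 2)
    {a : ℕ → Circle} (ha : IsGreedy lam a) :
    Tendsto (fun p : ℕ => secondOrderEnergy lam a ((4 ^ p - 1) / 3)) atTop
      (𝓝 (sConst lam)) := by
  have h := isBinaryRecursive_secondOrderEnergy hlam₁ hlam₂ ha
  have e := h.map_four_pow_sub_one_div_three (s := sTerm lam)
    (fun k => by rw [sTerm_eq, pow_mul, pow_mul]; norm_num)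
    (fun k => by
      rw [sTerm_eq, pow_succ, pow_succ, pow_mul, pow_mul]
      norm_num
      left
      field_simp
      ring)
  simp only [e, sConst]
  exact ((summable_sTerm hlam₁ hlam₂).hasSum.tendsto_sum_nat.comp
    (tendsto_id.const_mul_atTop' (by norm_num))).const_mul _

lemma tendsto_four_pow_sub_one_div_three :
    Tendsto (fun p : ℕ => (4 ^ p - 1) / 3) atTop atTop := by
  refine tendsto_atTop_mono (f := fun p => p) (fun p => ?_) tendsto_id
  have : 3 * p + 1 ≤ 4 ^ p := by
    induction p with
    | zero => simp
    | succ p ih => rw [pow_succ]; omega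
  omega

end GreedyEnergy

theorem theorem3p15 (lam : ℝ) (hlam₁ : 1 < lam) (hlam₂ : lam < 2)
    (a : ℕ → Circle) (ha₀ : a 0 = 1) (ha : GreedyEnergy.IsGreedy lam a) :
    -- the sequence is bounded and divergent
    (∃ C : ℝ, ∀ N : ℕ, 2 ≤ N → |GreedyEnergy.secondOrderEnergy lam a N| ≤ C) ∧
    (¬ ∃ l : ℝ, Tendsto (GreedyEnergy.secondOrderEnergy lam a) atTop (𝓝 l)) ∧
    -- its limit superior
    limsup (GreedyEnergy.secondOrderEnergy lam a) atTop = 0 ∧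
    -- the series defining the constant converges, its value is the limit along (4^p - 1) / 3,
    -- and it bounds the limit inferior from above
    Summable (GreedyEnergy.sTerm lam) ∧
    Tendsto (fun p : ℕ => GreedyEnergy.secondOrderEnergy lam a ((4 ^ p - 1) / 3)) atTop
      (𝓝 (GreedyEnergy.sConst lam)) ∧
    liminf (GreedyEnergy.secondOrderEnergy lam a) atTop ≤ GreedyEnergy.sConst lam ∧
    -- the limit inferior is the infimum over N ≥ 2
    IsGLB (GreedyEnergy.secondOrderEnergy lam a '' {N : ℕ | 2 ≤ N})
      (liminf (GreedyEnergy.secondOrderEnergy lam a) atTop) ∧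
    -- every term is the limit of a subsequence
    (∀ N : ℕ, 2 ≤ N → ∃ φ : ℕ → ℕ, StrictMono φ ∧
      Tendsto (fun k : ℕ => GreedyEnergy.secondOrderEnergy lam a (φ k)) atTop
        (𝓝 (GreedyEnergy.secondOrderEnergy lam a N))) := by
  have h := GreedyEnergy.isBinaryRecursive_secondOrderEnergy hlam₁ hlam₂ ha
  have hs := GreedyEnergy.tendsto_secondOrderEnergy_sConst hlam₁ hlam₂ ha
  obtain ⟨C, hC⟩ := h.exists_abs_le
  exact ⟨⟨C, fun N _ => hC N⟩, h.not_tendsto, h.limsup_eq_zero,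
    GreedyEnergy.summable_sTerm hlam₁ hlam₂, hs,
    h.liminf_le GreedyEnergy.tendsto_four_pow_sub_one_div_three hs, h.isGLB_liminf,
    fun N _ => h.exists_tendsto_subseq N⟩
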